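/- A class of groups $\mathcal{C}$ (closed under isomorphism) is called a root class if it contains a non-trivial group and is closed under taking subgroups, extensions, and Cartesian powers $\prod_{y \in Y} X_y$ with $X, Y \in \mathcal{C}$ and $X_y \cong X$ for every $y \in Y$. A group $X$ is residually a $\mathcal{C}$-group if for every $x \in X \setminus \{1\}$ there is a homomorphism $\sigma$ of $X$ onto a group from $\mathcal{C}$ with $x\sigma \neq 1$. A graph of groups $\mathcal{G}(\Gamma) = (\Gamma, G_v\ (v \in \mathcal{V}), H_e, \varphi_{\pm e}\ (e \in \mathcal{E}))$ over a non-empty connected undirected graph $\Gamma = (\mathcal{V}, \mathcal{E})$ (loops and multiple edges are allowed) assigns to each vertex $v$ a group $G_v$, and to each edge $e$ a direction, i.e. an ordering $e(1), e(-1)$ of its ends, a group $H_e$ and injective homomorphisms $\varphi_{\varepsilon e} : H_e \to G_{e(\varepsilon)}$ ($\varepsilon = \pm 1$); the subgroups $H_{\varepsilon e} = H_e\varphi_{\varepsilon e}$ are its edge subgroups. If $\mathcal{T} = (\mathcal{V}, \mathcal{E}_{\mathcal{T}})$ is a maximal tree in $\Gamma$, the fundamental group $\pi_1(\mathcal{G}(\Gamma),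 \mathcal{T})$ is generated by the groups $G_v$ ($v \in \mathcal{V}$) and symbols $t_e$ ($e \in \mathcal{E} \setminus \mathcal{E}_{\mathcal{T}}$), subject to the relations of the groups $G_v$ and the relations $h\varphi_{+e} = h\varphi_{-e}$ ($e \in \mathcal{E}_{\mathcal{T}}$, $h \in H_e$) and $t_e^{-1}(h\varphi_{+e})t_e = h\varphi_{-e}$ ($e \in \mathcal{E} \setminus \mathcal{E}_{\mathcal{T}}$, $h \in H_e$). Up to isomorphism it does not depend on $\mathcal{T}$ and is then denoted by $\pi_1(\mathcal{G}(\Gamma))$; the groups $G_v$ are identified with their images in it. **Theorem 3.** Let $\mathcal{C}$ be a root class of groups that consists of periodic groups and contains at least one infinite group. Then for any non-empty connected undirected graph $\Gamma = (\mathcal{V}, \mathcal{E})$ with a non-empty set of edges there exists a graph of groups $\mathcal{G}(\Gamma) = (\Gamma, G_v\ (v \in \mathcal{V}), H_e, \varphi_{\pm e}\ (e \in \mathcal{E}))$ such that: 1) all groups $G_v$ ($v \in \mathcal{V}$) belong to $\mathcal{C}$; 2) all subgroups $H_{\varepsilon e}$ ($e \in \mathcal{E}$, $\varepsilon = \pm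 1$) are non-trivial; 3) $\pi_1(\mathcal{G}(\Gamma))$ is residually a $\mathcal{C}$-group; 4) if $\mathcal{T}$ is a maximal tree in $\Gamma$ and $\sigma$ is a homomorphism of $\pi_1(\mathcal{G}(\Gamma), \mathcal{T})$ onto a group from $\mathcal{C}$, then $\ker \sigma \cap H_{\varepsilon e} \neq 1$ for any $e \in \mathcal{E}$, $\varepsilon = \pm 1$. -/

import Mathlib

universe u v w

/-- `C` is a root class of groups: an (isomorphism-closed) class of groups that contains a
non-trivial group and is closed under taking subgroups, extensions, and Cartesian powers
`∏_{y ∈ Y} X_y` with `X, Y ∈ C` and every `X_y` a copy of `X`. -/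
structure IsRootClass (C : ∀ (G : Type u) [Group G], Prop) : Prop where
  of_mulEquiv : ∀ (G H : Type u) [Group G] [Group H], (G ≃* H) → C G → C H
  exists_nontrivial : ∃ (G : Type u) (_ : Group G), C G ∧ Nontrivial G
  subgroup : ∀ (G : Type u) [Group G], C G → ∀ K : Subgroup G, C K
  extension : ∀ (G : Type u) [Group G] (N : Subgroup G) [N.Normal], C N → C (G ⧸ N) → C G
  power : ∀ (X Y : Type u) [Group X] [Group Y], C X → C Y → C (Y → X)

/-- `X` is residually a `C`-group: every non-trivial element of `X` survives in some homomorphism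
of `X` onto a `C`-group. -/
def IsResidually (C : ∀ (G : Type u) [Group G], Prop) (X : Type v) [Group X] : Prop :=
  ∀ x : X, x ≠ 1 → ∃ (Q : Type u) (_ : Group Q) (σ : X →* Q),
    C Q ∧ Function.Surjective σ ∧ σ x ≠ 1

namespace Graph

variable {α : Type v} {β : Type w}

/-- An undirected graph (with loops and multiple edges allowed) is connected if it is non-empty
and any two vertices are joined by a path. -/
def IsConnected (Γ : Graph α β) : Prop :=
  Γ.toSimpleGraph.Connected

/-- `T` is a maximal tree in `Γ`: a subgraph that is a tree (in particular without loops and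
multiple edges) and contains all vertices of `Γ`. -/
structure IsMaximalTree (T Γ : Graph α β) : Prop where
  spanning : T ≤s Γ
  simple : T.Simple
  isTree : T.toSimpleGraph.IsTree

end Graph

/-- A directed graph of groups over an undirected graph `Γ`. The Boolean `true` stands for the
sign `+1` and `false` for the sign `-1`; `e(ε)` is `endpt e ε`, so that `endpt` chooses a direction
of each edge. -/
structure GraphOfGroups {α : Type v} {β : Type w} (Γ : Graph α β) where
  vertexGroup : Γ.vertexSet → Type u
  [groupVertex : ∀ x, Group (vertexGroup x)]
  endpt : Γ.edgeSet → Bool → Γ.vertexSet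
  isLink_endpt : ∀ e : Γ.edgeSet, Γ.IsLink (e : β) (endpt e true) (endpt e false)
  edgeGroup : Γ.edgeSet → Type u
  [groupEdge : ∀ e, Group (edgeGroup e)]
  φ : ∀ (e : Γ.edgeSet) (ε : Bool), edgeGroup e →* vertexGroup (endpt e ε)
  φ_injective : ∀ e ε, Function.Injective (φ e ε)

namespace GraphOfGroups

variable {α : Type v} {β : Type w} {Γ : Graph α β}

attribute [instance] GraphOfGroups.groupVertex GraphOfGroups.groupEdge

variable (𝒢 : GraphOfGroups.{u} Γ) (T : Graph α β)

/-- The edge subgroup `H_{εe}` of the vertex group `G_{e(ε)}`. -/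
def edgeSubgroup (e : Γ.edgeSet) (ε : Bool) : Subgroup (𝒢.vertexGroup (𝒢.endpt e ε)) :=
  (𝒢.φ e ε).range

/-- The edges of `Γ` outside `T`; they index the symbols `t_e`. -/
abbrev StableEdge (Γ T : Graph α β) : Type w :=
  {e : Γ.edgeSet // (e : β) ∉ T.edgeSet}

/-- The group with the generators and relations of all vertex groups, the additional generators
`t_e` for the edges outside `T`, and no further relations. -/
abbrev PreFundamentalGroup : Type (max u v w) :=
  Monoid.Coprod (Monoid.CoprodI 𝒢.vertexGroup) (FreeGroup (StableEdge Γ T))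

/-- The canonical image of a vertex group in `PreFundamentalGroup`. -/
def preOf (x : Γ.vertexSet) : 𝒢.vertexGroup x →* 𝒢.PreFundamentalGroup T :=
  Monoid.Coprod.inl.comp Monoid.CoprodI.of

/-- The generator `t_e` in `PreFundamentalGroup`. -/
def preT (e : StableEdge Γ T) : 𝒢.PreFundamentalGroup T :=
  Monoid.Coprod.inr (FreeGroup.of e)

/-- The relators of the fundamental group that come from the edges:
`φ_{+e}(h) = φ_{-e}(h)` for the edges of `T` and
`t_e⁻¹ φ_{+e}(h) t_e = φ_{-e}(h)` for the other edges. -/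
inductive IsRelator : 𝒢.PreFundamentalGroup T → Prop
  | tree (e : Γ.edgeSet) (he : (e : β) ∈ T.edgeSet) (h : 𝒢.edgeGroup e) :
      IsRelator (𝒢.preOf T _ (𝒢.φ e true h) * (𝒢.preOf T _ (𝒢.φ e false h))⁻¹)
  | stable (e : StableEdge Γ T) (h : 𝒢.edgeGroup e.1) :
      IsRelator ((𝒢.preT T e)⁻¹ * 𝒢.preOf T _ (𝒢.φ e.1 true h) * 𝒢.preT T e *
        (𝒢.preOf T _ (𝒢.φ e.1 false h))⁻¹)

/-- The normal subgroup generated by the relators. -/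
def relatorClosure : Subgroup (𝒢.PreFundamentalGroup T) :=
  Subgroup.normalClosure {x | 𝒢.IsRelator T x}

instance : (𝒢.relatorClosure T).Normal :=
  inferInstanceAs (Subgroup.normalClosure _).Normal

/-- The fundamental group `π₁(𝒢(Γ), T)` of the graph of groups with respect to the maximal
tree `T`. -/
abbrev FundamentalGroup : Type (max u v w) :=
  𝒢.PreFundamentalGroup T ⧸ 𝒢.relatorClosure T

/-- The canonical homomorphism of a vertex group to the fundamental group. -/
def of (x : Γ.vertexSet) : 𝒢.vertexGroup x →* 𝒢.FundamentalGroup T :=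
  (QuotientGroup.mk' (𝒢.relatorClosure T)).comp (𝒢.preOf T x)

/-- The edge subgroup `H_{εe}` as a subgroup of the fundamental group. -/
def edgeSubgroupInFundamentalGroup (e : Γ.edgeSet) (ε : Bool) :
    Subgroup (𝒢.FundamentalGroup T) :=
  (𝒢.edgeSubgroup e ε).map (𝒢.of T (𝒢.endpt e ε))

end GraphOfGroups

/-! A group `Q` in `C` has finite exponent: otherwise a Cartesian power of `Q` over an infinite
group of `C` would contain an element of infinite order. So it suffices to build a graph of groups
whose edge subgroups all become one normal subgroup `H` of the fundamental group, on which some `g`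
acts with all positive powers acting non-trivially. If `n` is an exponent of the image of `σ`, then
`σ` kills the commutators of `g ^ n` with `H`, and some of them are non-trivial elements of `H`.

Residuality limits the choice of `H` and of the action. Fix a prime `p` such that `C` contains a
group `Z` of order `p`, hence all finite `p`-groups. Take finite `p`-groups `Q n` with elements `a
n`, `b n` of order dividing `p` and `(a n * b n) ^ (n + 1) ≠ 1`. In `D = ∏ n, Q n` the elements `a`
and `b` have order `p` and `a * b` has infinite order. Let `D` permute the countable set `Σ n, Q n`,
and let `H` be the group of all functions from it to `Z`. The vertex groups are `H ⋊ ⟨a⟩` and `H ⋊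
⟨b⟩`, the edge groups are `H`, and loops are twisted by `a * b`. `D` is not in `C`, but it acts only
through `⟨a⟩` or `⟨b⟩` in each vertex group.

An element of `H` is detected in a wreath product of `Z` and `Q n` (`exists_hom_ofBase`,
`sigmaProj`). Any other element is, modulo `H`, a non-empty reduced word in generators of order `p`
or infinite order, and it survives in a finite `p`-group of unitriangular matrices
(`exists_isPGroup_word_ne_one`). That theorem, applied to the word `(ab)^n`, also supplies the
groups `Q n`. -/

/-! ### Root classes of periodic groups -/

namespace IsRootClass

variable {C : ∀ (G : Type u) [Group G], Prop}

theorem of_injective (hC : IsRootClass C) {G H : Type u} [Group G] [Group H] (f : G →* H)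
    (hf : Function.Injective f) (hH : C H) : C G :=
  hC.of_mulEquiv _ _ (MonoidHom.ofInjective hf).symm (hC.subgroup H hH f.range)

theorem of_ker (hC : IsRootClass C) {G H : Type u} [Group G] [Group H] (f : G →* H)
    (hker : C f.ker) (hH : C H) : C G :=
  hC.extension G f.ker hker
    (hC.of_mulEquiv _ _ (QuotientGroup.quotientKerEquivRange f).symm (hC.subgroup H hH f.range))

theorem semidirectProduct (hC : IsRootClass C) {N K : Type u} [Group N] [Group K]
    (φ : K →* MulAut N) (hN : C N) (hK : C K) : C (N ⋊[φ] K) := by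
  refine hC.of_ker SemidirectProduct.rightHom ?_ hK
  rw [← SemidirectProduct.range_inl_eq_ker_rightHom]
  exact hC.of_mulEquiv _ _ (MonoidHom.ofInjective SemidirectProduct.inl_injective) hN

theorem of_subsingleton (hC : IsRootClass C) (G : Type u) [Group G] [Subsingleton G] : C G := by
  obtain ⟨X, _, hX, -⟩ := hC.exists_nontrivial
  exact hC.of_injective (1 : G →* X) (Function.injective_of_subsingleton _) hX

/-- A root class of periodic groups contains a group of prime order. -/
theorem exists_prime_card (hC : IsRootClass C)
    (hperiodic : ∀ (G : Type u) [Group G], C G → IsMulTorsion G) :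
    ∃ (p : ℕ) (Z : Type u) (_ : Group Z), p.Prime ∧ C Z ∧ Nat.card Z = p := by
  obtain ⟨X, _, hX, hnt⟩ := hC.exists_nontrivial
  obtain ⟨x, hx⟩ := exists_ne (1 : X)
  have hfin := hperiodic X hX x
  have h1 : orderOf x ≠ 1 := fun h => hx (orderOf_eq_one_iff.1 h)
  obtain ⟨p, hp, hdvd⟩ := Nat.exists_prime_and_dvd h1
  have hy : orderOf (x ^ (orderOf x / p)) = p :=
    orderOf_pow_orderOf_div hfin.orderOf_pos.ne' hdvd
  refine ⟨p, Subgroup.zpowers (x ^ (orderOf x / p)), inferInstance, hp,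
    hC.subgroup X hX _, ?_⟩
  rw [Nat.card_zpowers, hy]

/-- A root class with a group of prime order `p` contains all finite `p`-groups. -/
theorem of_isPGroup (hC : IsRootClass C) {p : ℕ} (hp : p.Prime) {Z : Type u} [Group Z]
    (hZ : C Z) (hcard : Nat.card Z = p) (P : Type u) [Group P] [Finite P] (hP : IsPGroup p P) :
    C P := by
  have := Fact.mk hp
  induction hn : Nat.card P using Nat.strong_induction_on generalizing P with
  | _ n ih =>
    rcases subsingleton_or_nontrivial P with _ | _
    · exact hC.of_subsingleton P
    have := hP.center_nontrivial
    obtain ⟨k, hk⟩ := IsPGroup.iff_card.1 (hP.to_subgroup (Subgroup.center P))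
    have hk0 : k ≠ 0 := by
      rintro rfl
      rw [pow_zero] at hk
      exact Finite.one_lt_card.ne' hk
    obtain ⟨c, hc⟩ := exists_prime_orderOf_dvd_card' (G := Subgroup.center P) p
      (hk ▸ dvd_pow_self p hk0)
    have hc' : orderOf (c : P) = p := by rw [Subgroup.orderOf_coe, hc]
    have : (Subgroup.zpowers (c : P)).Normal := by
      refine ⟨fun n hn g => ?_⟩
      rw [Subgroup.mem_center_iff.1 ((Subgroup.zpowers_le).2 c.2 hn) g, mul_inv_cancel_right]
      exact hn
    have hN : Nat.card (Subgroup.zpowers (c : P)) = p := by rw [Nat.card_zpowers, hc']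
    have hmul := Subgroup.card_eq_card_quotient_mul_card_subgroup (Subgroup.zpowers (c : P))
    rw [hN] at hmul
    refine hC.extension P (Subgroup.zpowers (c : P))
      (hC.of_mulEquiv _ _ (mulEquivOfPrimeCardEq hcard hN) hZ) ?_
    refine ih _ ?_ _ (hP.to_quotient _) rfl
    rw [← hn, hmul]
    exact lt_mul_of_one_lt_right Nat.card_pos hp.one_lt

/-- Powers are available only over index sets that are groups of `C`. Embedding `Ω` in the infinite
group `Y` and extending functions by `1` makes `Ω → X` a subgroup of `Y → X`. -/
theorem pi_of_countable (hC : IsRootClass C) {X Y : Type u} [Group X] [Group Y] (hX : C X)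
    (hY : C Y) [Infinite Y] (Ω : Type u) [Countable Ω] : C (Ω → X) := by
  obtain ⟨i⟩ : Nonempty (Ω ↪ Y) := by
    obtain ⟨f, hf⟩ := exists_injective_nat Ω
    exact ⟨(⟨f, hf⟩ : Ω ↪ ℕ).trans (Infinite.natEmbedding Y)⟩
  refine hC.of_injective (Function.ExtendByOne.hom X i) (fun f g h => ?_) (hC.power X Y hX hY)
  funext ω
  have := congrFun h (i ω)
  simpa [Function.ExtendByOne.hom, i.injective.extend_apply] using this

/-- In a root class of periodic groups with an infinite member, every group has finite exponent. -/
theorem exists_pow_eq_one (hC : IsRootClass C)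
    (hperiodic : ∀ (G : Type u) [Group G], C G → IsMulTorsion G)
    {Y : Type u} [Group Y] [Infinite Y] (hY : C Y) {Q : Type u} [Group Q] (hQ : C Q) :
    ∃ n : ℕ, 0 < n ∧ ∀ q : Q, q ^ n = 1 := by
  by_contra! hne
  -- The elements `q n` with `q n ^ n! ≠ 1` are collected in one element of `Y → Q`. If it has
  -- finite order dividing `m > 0`, its coordinate `q m` contradicts `m ∣ m!`.
  choose q hq using fun n : ℕ => hne n.factorial n.factorial_pos
  let i := Infinite.natEmbedding Y
  obtain ⟨m, hm, hpow⟩ := isOfFinOrder_iff_pow_eq_one.1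
    (hperiodic (Y → Q) (hC.power Q Y hQ hY) (Function.extend i q 1))
  have h := congrFun hpow (i m)
  rw [Pi.pow_apply, i.injective.extend_apply, Pi.one_apply] at h
  obtain ⟨c, hc⟩ := Nat.dvd_factorial hm le_rfl
  exact hq m (by rw [hc, pow_mul, h, one_pow])

theorem exists_of_ne_one (hC : IsRootClass C) {X : Type v} [Group X] {Q : Type u} [Group Q]
    (hQ : C Q) (f : X →* Q) {x : X} (hx : f x ≠ 1) :
    ∃ (Q : Type u) (_ : Group Q) (σ : X →* Q), C Q ∧ Function.Surjective σ ∧ σ x ≠ 1 :=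
  ⟨f.range, inferInstance, f.rangeRestrict, hC.subgroup Q hQ _, f.rangeRestrict_surjective,
    fun h => hx (congrArg Subtype.val h)⟩

end IsRootClass

/-! ### Words acting by unitriangular matrices over `ZMod p` -/

namespace Unitriangular

variable (p N : ℕ)

/-- The unipotent automorphisms of `(ZMod p)^N` with respect to the standard flag. -/
def group : Subgroup (Module.End (ZMod p) (Fin N → ZMod p))ˣ where
  carrier := {g | ∀ (n : ℕ) (f : Fin N → ZMod p), (∀ r : Fin N, (r : ℕ) < n → f r = 0) →
    ∀ r : Fin N, (r : ℕ) ≤ n → g.1 f r = f r}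
  one_mem' _ _ _ _ _ := rfl
  mul_mem' {g h} hg hh n f hf r hr := by
    have h1 := hh n f hf
    rw [Units.val_mul, Module.End.mul_apply,
      hg n (h.1 f) (fun r hr => (h1 r hr.le).trans (hf r hr)) r hr, h1 r hr]
  inv_mem' {g} hg := by
    -- `g` does not change the first non-zero coordinate, so `f` vanishes as far as `g f` does.
    have key : ∀ (n : ℕ) (f : Fin N → ZMod p), (∀ r : Fin N, (r : ℕ) < n → g.1 f r = 0) →
        ∀ j ≤ n, ∀ r : Fin N, (r : ℕ) < j → f r = 0 := by
      intro n f hf j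
      induction j with
      | zero => intro _ r hr; omega
      | succ j ih =>
        intro hj r hr
        have := ih (by omega)
        rw [← hg j f this r (by omega)]
        exact hf r (by omega)
    intro n f hf r hr
    have hinv : ∀ f, g.1 (g⁻¹.1 f) = f := fun f => by
      rw [← Module.End.mul_apply, ← Units.val_mul, mul_inv_cancel]; rfl
    have h0 := key n (g⁻¹.1 f) (fun r hr => by rw [hinv]; exact hf r hr) n le_rfl
    rw [← hg n _ h0 r hr, hinv]

/-- `g - 1` moves each member of the standard flag into the next, so it is nilpotent; in
characteristic `p` this makes `g` an element of `p`-power order. -/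
theorem sub_one_pow_apply {g : (Module.End (ZMod p) (Fin N → ZMod p))ˣ} (hg : g ∈ group p N)
    (n : ℕ) (f : Fin N → ZMod p) (r : Fin N) (hr : (r : ℕ) < n) :
    ((g.1 - 1) ^ n) f r = 0 := by
  induction n generalizing r with
  | zero => omega
  | succ n ih =>
    rw [pow_succ', Module.End.mul_apply, LinearMap.sub_apply, Pi.sub_apply, Module.End.one_apply,
      hg n _ ih r (by omega), sub_self]

variable [Fact p.Prime]

theorem add_pow_eq {R : Type*} [Ring R] [CharP R p] (x : R) (n : ℕ) :
    (1 + x) ^ p ^ n = 1 + x ^ p ^ n := by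
  rw [add_pow_char_pow_of_commute p n (Commute.one_left x), one_pow]

instance [NeZero N] : CharP (Module.End (ZMod p) (Fin N → ZMod p)) p :=
  charP_of_injective_algebraMap
    (FaithfulSMul.algebraMap_injective (ZMod p) (Module.End (ZMod p) (Fin N → ZMod p))) p

theorem one_add_pow_eq_one [NeZero N] {x : Module.End (ZMod p) (Fin N → ZMod p)}
    (hx : x ^ N = 0) : (1 + x) ^ p ^ N = 1 := by
  rw [add_pow_eq, pow_eq_zero_of_le (Nat.lt_pow_self (Fact.out : p.Prime).one_lt).le hx, add_zero]

theorem isPGroup [NeZero N] : IsPGroup p (group p N) := by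
  rintro ⟨g, hg⟩
  refine ⟨N, Subtype.ext (Units.ext ?_)⟩
  have h : (g.1 - 1) ^ N = 0 := by
    ext f r
    simpa using sub_one_pow_apply p N hg N _ r r.2
  simpa using one_add_pow_eq_one p N h

instance : Finite (group p N) := by
  have : Finite (Module.End (ZMod p) (Fin N → ZMod p)) := DFunLike.finite _
  infer_instance

variable {ι : Type v} (lab : ℕ → Option ι)

open Classical in
/-- The nilpotent operator that moves the basis vector `j` to `j + 1` if `j` has label `i`. -/
noncomputable def shift (i : ι) : Module.End (ZMod p) (Fin N → ZMod p) where
  toFun f r := if h : 0 < (r : ℕ) then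
    if lab (r - 1) = some i then f ⟨r - 1, by omega⟩ else 0 else 0
  map_add' f g := by ext r; dsimp; split_ifs <;> simp
  map_smul' c f := by ext r; dsimp; split_ifs <;> simp

variable {p N}

theorem shift_apply_eq_zero (i : ι) (f : Fin N → ZMod p) (r : Fin N)
    (h : ∀ h : 0 < (r : ℕ), lab (r - 1) = some i → f ⟨r - 1, by omega⟩ = 0) :
    shift p N lab i f r = 0 := by
  change (dite _ _ _) = _
  split_ifs with h1 h2
  exacts [h h1 h2, rfl, rfl]

theorem shift_pow_apply (i : ι) (n : ℕ) (f : Fin N → ZMod p) (r : Fin N) (hr : (r : ℕ) < n) :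
    ((shift p N lab i) ^ n) f r = 0 := by
  induction n generalizing r with
  | zero => omega
  | succ n ih =>
    rw [pow_succ', Module.End.mul_apply]
    exact shift_apply_eq_zero lab i _ r fun h _ => ih _ (by simp; omega)

theorem shift_pow_eq_zero (i : ι) : (shift p N lab i) ^ N = 0 := by
  ext f r
  simpa using shift_pow_apply lab i N _ r r.2

/-- The operator `1 + shift i` as a unit. -/
noncomputable def gen [NeZero N] (i : ι) : (Module.End (ZMod p) (Fin N → ZMod p))ˣ :=
  Units.ofPowEqOne (1 + shift p N lab i) (p ^ N) (one_add_pow_eq_one p N (shift_pow_eq_zero lab i))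
    (pow_ne_zero _ (Fact.out : p.Prime).ne_zero)

theorem val_gen [NeZero N] (i : ι) : (gen (p := p) (N := N) lab i).1 = 1 + shift p N lab i := rfl

theorem gen_mem [NeZero N] (i : ι) : gen (p := p) (N := N) lab i ∈ group p N := by
  intro n f hf r hr
  rw [val_gen, LinearMap.add_apply, Pi.add_apply, Module.End.one_apply,
    shift_apply_eq_zero lab i f r fun h _ => hf _ (by simp; omega), add_zero]

variable (p N) in
/-- The basis vector with index `j`, and `0` if `j` is too large. -/
def basisVec (j : ℕ) : Fin N → ZMod p := fun r => if (r : ℕ) = j then 1 else 0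

theorem basisVec_apply (j : ℕ) (r : Fin N) :
    basisVec p N j r = if (r : ℕ) = j then 1 else 0 := rfl

theorem shift_basisVec_of_eq {i : ι} {j : ℕ} (h : lab j = some i) :
    shift p N lab i (basisVec p N j) = basisVec p N (j + 1) := by
  ext r
  change (dite _ _ _) = _
  simp only [basisVec]
  by_cases hr : (r : ℕ) = j + 1
  · simp [hr, h]
  · rw [if_neg hr]
    split_ifs <;> first | rfl | omega

theorem shift_basisVec_of_ne {i : ι} {j : ℕ} (h : lab j ≠ some i) :
    shift p N lab i (basisVec p N j) = 0 := by
  ext r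
  refine shift_apply_eq_zero lab i _ r fun h1 h2 => if_neg ?_
  rintro h3
  exact h (h3 ▸ h2)

theorem shift_pow_basisVec {i : ι} {j d : ℕ} (h : ∀ a < d, lab (j + a) = some i) :
    ((shift p N lab i) ^ d) (basisVec p N j) = basisVec p N (j + d) := by
  induction d with
  | zero => rfl
  | succ d ih =>
    rw [pow_succ', Module.End.mul_apply, ih fun a ha => h a (by omega),
      shift_basisVec_of_eq lab (h d (by omega))]
    rfl

variable [NeZero N]

/-- When no two consecutive labels equal `i`, two shifts cannot be composed, so the shift squares to
zero and `(1 + s)^p = 1 + s^p = 1`. -/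
theorem gen_pow_prime {i : ι} (h : ∀ j, lab j = some i → lab (j + 1) ≠ some i) :
    (gen (p := p) (N := N) lab i) ^ p = 1 := by
  have h2 : (shift p N lab i) ^ 2 = 0 := by
    ext f r
    rw [LinearMap.comp_apply, pow_two, Module.End.mul_apply]
    refine shift_apply_eq_zero lab i _ r fun h1 h2 => ?_
    refine shift_apply_eq_zero lab i _ _ fun h3 h4 => ?_
    simp only at h3 h4
    refine absurd ?_ (h _ h4)
    rwa [Nat.sub_add_cancel h3]
  refine Units.ext ?_
  have := add_pow_eq p (shift p N lab i) 1
  rw [pow_one, pow_eq_zero_of_le (Fact.out : p.Prime).two_le h2, add_zero] at this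
  simpa [val_gen] using this

instance : Finite (Module.End (ZMod p) (Fin N → ZMod p))ˣ := by
  have : Finite (Module.End (ZMod p) (Fin N → ZMod p)) := DFunLike.finite _
  infer_instance

/-- `gen i` preserves the vectors supported in `[0, s)` if `s` starts a new block of labels. -/
theorem gen_zpow_apply_eq_zero {i : ι} {s : ℕ} (h : ∀ j, j + 1 = s → lab j ≠ some i) (k : ℤ)
    {f : Fin N → ZMod p} (hf : ∀ r : Fin N, s ≤ r → f r = 0) (r : Fin N) (hr : s ≤ r) :
    ((gen (p := p) lab i) ^ k).1 f r = 0 := by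
  -- The unit group is finite, so an integer power is also a natural one and ordinary induction
  -- applies.
  obtain ⟨n, hn⟩ := mem_powers_iff_mem_zpowers.2 (Subgroup.mem_zpowers_iff.2
    ⟨k, rfl⟩ : (gen (p := p) (N := N) lab i) ^ k ∈ Subgroup.zpowers (gen lab i))
  simp only at hn
  rw [← hn]
  clear hn
  induction n generalizing r with
  | zero => exact hf r hr
  | succ n ih =>
    rw [pow_succ', Units.val_mul, Module.End.mul_apply, val_gen, LinearMap.add_apply, Pi.add_apply,
      Module.End.one_apply, ih r hr, zero_add]
    refine shift_apply_eq_zero lab i _ r fun h1 h2 => ?_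
    by_cases hrs : (r : ℕ) = s
    · exact absurd h2 (h _ (by omega))
    · exact ih _ (by simp; omega)

theorem zpow_apply_eq_add {R M : Type*} [CommRing R] [AddCommGroup M] [Module R M]
    (g : (Module.End R M)ˣ) {x y : M} (hx : g.1 x = x + y) (hy : g.1 y = y) (k : ℤ) :
    (g ^ k).1 x = x + k • y := by
  have hinv : ∀ z w, g.1 z = w → g⁻¹.1 w = z := by
    rintro z _ rfl
    rw [← Module.End.mul_apply, ← Units.val_mul, inv_mul_cancel]; rfl
  have hy' := hinv _ _ hy
  have hx' : g⁻¹.1 x = x - y := by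
    have := hinv _ _ hx
    rw [map_add, hy'] at this
    exact eq_sub_of_add_eq this
  induction k using Int.induction_on with
  | zero => simp
  | succ n ih =>
    rw [zpow_add_one, ((Commute.refl g).zpow_left n).eq, Units.val_mul, Module.End.mul_apply, ih,
      map_add, map_zsmul, hx, hy, add_smul, one_smul]
    abel
  | pred n ih =>
    rw [zpow_sub_one, ((Commute.refl g).inv_right.zpow_left (-n)).eq, Units.val_mul,
      Module.End.mul_apply, ih, map_add, map_zsmul, hx', hy', sub_smul, one_smul]
    abel

/-- In characteristic `p`, `(1 + s)^(p^t) = 1 + s^(p^t)`, which jumps across the whole block of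
`p^t` labels at once. The block ends there, so a second jump gives zero, and the power acts as a
transvection. -/
theorem gen_zpow_basisVec {i : ι} {j t : ℕ} (h : ∀ a < p ^ t, lab (j + a) = some i)
    (h' : lab (j + p ^ t) ≠ some i) (k : ℤ) :
    ((gen lab i) ^ ((p : ℤ) ^ t * k)).1 (basisVec p N j) =
      basisVec p N j + k • basisVec p N (j + p ^ t) := by
  have hg : ((gen (p := p) (N := N) lab i) ^ (p : ℤ) ^ t).1 = 1 + (shift p N lab i) ^ p ^ t := by
    rw [← add_pow_eq, ← val_gen, ← Units.val_pow_eq_pow_val]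
    norm_cast
  rw [zpow_mul]
  refine zpow_apply_eq_add _ ?_ ?_ k
  · rw [hg, LinearMap.add_apply, shift_pow_basisVec lab h]; rfl
  · have hzero : ((shift p N lab i) ^ p ^ t) (basisVec p N (j + p ^ t)) = 0 := by
      have hmul := pow_succ (shift p N lab i) (p ^ t - 1)
      rw [Nat.sub_add_cancel (Nat.pow_pos (Fact.out : p.Prime).pos)] at hmul
      rw [hmul, Module.End.mul_apply, shift_basisVec_of_ne lab h', map_zero]
    rw [hg, LinearMap.add_apply, hzero, add_zero]; rfl

variable (p) in
/-- The labels of a word: each syllable `(i, k)` contributes as many labels `i` as the `p`-part of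
`k` says. -/
noncomputable def labels : List (ι × ℤ) → List ι
  | [] => []
  | x :: l => labels l ++ List.replicate (p ^ multiplicity (p : ℤ) x.2) x.1

omit [NeZero N] in
theorem mem_getLast_labels {x y : ι} {k : ℤ} {l : List (ι × ℤ)}
    (h : y ∈ (labels p ((x, k) :: l)).getLast?) : y = x := by
  have h0 : p ^ multiplicity (p : ℤ) k ≠ 0 := pow_ne_zero _ (Fact.out : p.Prime).ne_zero
  rw [labels, List.getLast?_append, List.getLast?_replicate, if_neg h0] at h
  simpa using h.symm

/-- A generator that must have order `p` occurs with exponents prime to `p`, so its blocks have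
length `p^0 = 1`; neighbouring blocks differ because the word is reduced. -/
theorem isChain_labels {o : ι → Prop} {l : List (ι × ℤ)}
    (hl : l.IsChain fun x y => x.1 ≠ y.1) (ho : ∀ x ∈ l, o x.1 → ¬ (p : ℤ) ∣ x.2) :
    (labels p l).IsChain fun i j => o i → i ≠ j := by
  induction l with
  | nil => exact List.IsChain.nil
  | cons x l ih =>
    rw [labels, List.isChain_append]
    refine ⟨ih hl.tail fun y hy => ho y (List.mem_cons_of_mem _ hy), ?_, ?_⟩
    · by_cases hx : o x.1
      · rw [multiplicity_eq_zero.2 (ho x (List.mem_cons_self ..) hx)]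
        simp
      · exact List.isChain_replicate_of_rel _ fun h => absurd h hx
    · intro a ha b hb _
      rcases l with _ | ⟨y, l⟩
      · simp [labels] at ha
      have h1 := mem_getLast_labels ha
      have h2 := (List.mem_replicate.1 (List.mem_of_mem_head? hb)).2
      rw [h1, h2]
      exact fun h => (List.isChain_cons_cons.1 hl).1 h.symm

/-- The syllables act from the right, each carrying the leading basis vector to the end of its own
block and multiplying the coefficient by the `p`-free part of its exponent, a unit mod `p`. Lower
terms cannot catch up, because the label just before a block is different from that of the block. -/
theorem exists_word_basisVec {l : List (ι × ℤ)} (hl : l.IsChain fun x y => x.1 ≠ y.1)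
    (h0 : ∀ x ∈ l, x.2 ≠ 0) (hN : (labels p l).length < N)
    (hlab : ∀ j < (labels p l).length, lab j = (labels p l)[j]?)
    (hlast : ∀ x ∈ l.head?, lab (labels p l).length ≠ some x.1) :
    ∃ (c : ZMod p) (f : Fin N → ZMod p), c ≠ 0 ∧
      (∀ r : Fin N, (labels p l).length ≤ r → f r = 0) ∧
      ((l.map fun x => (gen lab x.1) ^ x.2).prod).1 (basisVec p N 0) =
        c • basisVec p N (labels p l).length + f := by
  induction l with
  | nil => exact ⟨1, 0, one_ne_zero, fun _ _ => rfl, by simp [labels]⟩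
  | cons x l ih =>
    obtain ⟨i, k⟩ := x
    have hlen : (labels p ((i, k) :: l)).length
        = (labels p l).length + p ^ multiplicity (p : ℤ) k := by simp [labels]
    have hpos : 0 < p ^ multiplicity (p : ℤ) k := pow_pos (Fact.out : p.Prime).pos _
    have hk : k ≠ 0 := h0 (i, k) (List.mem_cons_self ..)
    obtain ⟨k', hk', hdvd⟩ := FiniteMultiplicity.exists_eq_pow_mul_and_not_dvd
      (Int.finiteMultiplicity_iff.2 ⟨by simpa using (Fact.out : p.Prime).ne_one, hk⟩ :
        FiniteMultiplicity (p : ℤ) k)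
    set t := multiplicity (p : ℤ) k with ht
    set s := (labels p l).length with hs
    have hblock : ∀ a < p ^ t, lab (s + a) = some i := fun a ha => by
      rw [hlab _ (by omega)]
      simp [labels, ← hs, ← ht, ha]
    have hold : ∀ j < s, lab j = (labels p l)[j]? := fun j hj => by
      rw [hlab _ (by omega)]
      simp only [labels]
      rw [List.getElem?_append_left hj]
    have hend : lab (s + p ^ t) ≠ some i := by
      have := hlast (i, k) rfl
      rwa [hlen] at this
    have hstart : lab s = some i := hblock 0 hpos
    have hne : ∀ x ∈ l.head?, i ≠ x.1 := by
      rcases l with _ | ⟨y, l⟩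
      · simp
      · simpa using (List.isChain_cons_cons.1 hl).1
    obtain ⟨c, f, hc, hf, heq⟩ := ih hl.tail (fun y hy => h0 y (List.mem_cons_of_mem _ hy))
      (by omega) hold (fun x hx h => hne x hx (Option.some.inj (hstart.symm.trans h)))
    have hbd : ∀ j, j + 1 = s → lab j ≠ some i := by
      intro j hj h
      rcases l with _ | ⟨⟨y, m⟩, l⟩
      · simp [labels] at hs; omega
      refine hne _ rfl (mem_getLast_labels (p := p) (k := m) (l := l) ?_)
      rw [List.getLast?_eq_getElem?, ← hs, ← hj, Nat.add_sub_cancel, ← hold j (by omega), h]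
      rfl
    have hword := gen_zpow_basisVec (p := p) (N := N) lab hblock hend k'
    rw [← hk'] at hword
    refine ⟨c * k', c • basisVec p N s + ((gen lab i) ^ k).1 f, ?_, ?_, ?_⟩
    · refine mul_ne_zero hc fun h => hdvd ?_
      exact (ZMod.intCast_zmod_eq_zero_iff_dvd k' p).1 h
    · intro r hr
      rw [hlen] at hr
      have h1 := gen_zpow_apply_eq_zero lab hbd k hf r (by omega)
      rw [Pi.add_apply, h1, add_zero, Pi.smul_apply, basisVec, if_neg (by omega), smul_zero]
    · rw [List.map_cons, List.prod_cons, Units.val_mul, Module.End.mul_apply, heq, map_add,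
        map_smul, hword, hlen, smul_add, ← Int.cast_smul_eq_zsmul (ZMod p), smul_smul]
      abel

end Unitriangular

/-! ### Reduced words and finite `p`-groups -/

/-- Every word in generators some of which have order `p` can be reduced. -/
theorem exists_reduced_word {G : Type w} [Group G] {p : ℕ} {ι : Type v} (o : ι → Prop) (y : ι → G)
    (hy : ∀ i, o i → y i ^ p = 1) (l : List (ι × ℤ)) :
    ∃ l' : List (ι × ℤ), l'.IsChain (fun x y => x.1 ≠ y.1) ∧
      (∀ x ∈ l', x.2 ≠ 0 ∧ (o x.1 → ¬ (p : ℤ) ∣ x.2)) ∧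
      (l.map fun x => y x.1 ^ x.2).prod = (l'.map fun x => y x.1 ^ x.2).prod := by
  have hone : ∀ i (k : ℤ), ¬ (k ≠ 0 ∧ (o i → ¬ (p : ℤ) ∣ k)) → y i ^ k = 1 := by
    intro i k h
    by_cases hk : k = 0
    · rw [hk, zpow_zero]
    · have : o i ∧ (p : ℤ) ∣ k := by tauto
      obtain ⟨hi, c, rfl⟩ := this
      rw [zpow_mul, zpow_natCast, hy i hi, one_zpow]
  induction l with
  | nil => exact ⟨[], List.IsChain.nil, by simp, rfl⟩
  | cons x l ih =>
    obtain ⟨i, k⟩ := x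
    obtain ⟨l', hch, hgood, heq⟩ := ih
    rw [List.map_cons, List.prod_cons, heq]
    by_cases hk : k ≠ 0 ∧ (o i → ¬ (p : ℤ) ∣ k)
    swap
    · exact ⟨l', hch, hgood, by rw [hone i k hk, one_mul]⟩
    rcases l' with _ | ⟨⟨j, m⟩, l'⟩
    · exact ⟨[(i, k)], List.isChain_singleton _, by simpa using hk, by simp⟩
    by_cases hij : i = j
    · subst hij
      have hmul : y i ^ k * ((((i, m) :: l').map fun x => y x.1 ^ x.2).prod) =
          y i ^ (k + m) * (l'.map fun x => y x.1 ^ x.2).prod := by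
        rw [List.map_cons, List.prod_cons, ← mul_assoc, zpow_add]
      by_cases hkm : k + m ≠ 0 ∧ (o i → ¬ (p : ℤ) ∣ k + m)
      · refine ⟨(i, k + m) :: l', ?_, ?_, hmul⟩
        · cases hch with
          | singleton => exact List.isChain_singleton _
          | cons_cons h1 h2 => exact List.IsChain.cons_cons h1 h2
        · rintro x (_ | ⟨_, hx⟩)
          · exact hkm
          · exact hgood x (List.mem_cons_of_mem _ hx)
      · exact ⟨l', hch.tail, fun x hx => hgood x (List.mem_cons_of_mem _ hx),
          by rw [hmul, hone i _ hkm, one_mul]⟩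
    · refine ⟨(i, k) :: (j, m) :: l', List.IsChain.cons_cons hij hch, ?_, rfl⟩
      rintro x (_ | ⟨_, hx⟩)
      · exact hk
      · exact hgood x hx

open Unitriangular in
/-- A reduced word in generators some of which have order `p` survives in a finite `p`-group. -/
theorem exists_isPGroup_word_ne_one {p : ℕ} (hp : p.Prime) {ι : Type v} (o : ι → Prop)
    {l : List (ι × ℤ)} (hnil : l ≠ []) (hl : l.IsChain fun x y => x.1 ≠ y.1)
    (h0 : ∀ x ∈ l, x.2 ≠ 0) (ho : ∀ x ∈ l, o x.1 → ¬ (p : ℤ) ∣ x.2) :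
    ∃ (P : Type u) (_ : Group P) (y : ι → P), Finite P ∧ IsPGroup p P ∧
      (∀ i, o i → y i ^ p = 1) ∧ (l.map fun x => y x.1 ^ x.2).prod ≠ 1 := by
  have := Fact.mk hp
  set L := labels p l with hL
  -- Past the end the label is `none`, so the final block stops there. The dimension is one more
  -- than the number of labels, so the leading vector is the last basis vector, and its coordinate
  -- contradicts the word being `1`.
  let lab : ℕ → Option ι := fun j => L[j]?
  let N := L.length + 1
  let y : ι → group p N := fun i => ⟨gen lab i, gen_mem lab i⟩
  have hpow : ∀ i, o i → y i ^ p = 1 := by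
    intro i hi
    refine Subtype.ext (gen_pow_prime lab fun j h1 h2 => ?_)
    have hch := isChain_labels hl ho
    obtain ⟨hj1, h1⟩ := List.getElem?_eq_some_iff.1 h1
    obtain ⟨hj2, h2⟩ := List.getElem?_eq_some_iff.1 h2
    have := List.isChain_iff_getElem.1 hch j hj2
    rw [h1, h2] at this
    exact this hi rfl
  have hne : (l.map fun x => y x.1 ^ x.2).prod ≠ 1 := by
    intro h
    obtain ⟨c, f, hc, hf, heq⟩ := exists_word_basisVec (p := p) (N := N) lab hl h0
      (Nat.lt_succ_self _) (fun _ _ => rfl) (fun x _ => by simp [lab, hL])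
    have hcoe := congrArg (group p N).subtype h
    rw [map_list_prod, List.map_map, map_one] at hcoe
    have hcoe' : (l.map fun x => (gen (p := p) (N := N) lab x.1) ^ x.2).prod = 1 := hcoe
    rw [hcoe', Units.val_one, Module.End.one_apply] at heq
    have hlen : 0 < (labels p l).length := by
      rcases l with _ | ⟨x, l⟩
      · exact absurd rfl hnil
      · have := pow_pos hp.pos (multiplicity (p : ℤ) x.2)
        simp only [labels, List.length_append, List.length_replicate]
        omega
    have := congrFun heq (Fin.last L.length)
    rw [Pi.add_apply, hf _ (by simp [hL])] at this
    rw [Pi.smul_apply, basisVec_apply, basisVec_apply, Fin.val_last, if_neg (hL ▸ hlen.ne'), if_pos rfl,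
      smul_eq_mul, mul_one, add_zero] at this
    exact hc this.symm
  refine ⟨ULift.{u} (group p N), inferInstance, fun i => ⟨y i⟩, inferInstance, ?_, ?_, ?_⟩
  · exact (Unitriangular.isPGroup p N).of_equiv MulEquiv.ulift.symm
  · exact fun i hi => ULift.ext _ _ (hpow i hi)
  · intro h
    apply hne
    have := congrArg (MulEquiv.ulift (α := group p N)) h
    rw [map_list_prod, List.map_map, map_one] at this
    exact this

/-- For every `n > 0` there is a finite `p`-group with two elements of order `p` whose product has
`n`-th power different from `1`. -/
theorem exists_isPGroup_mul_pow_ne_one {p : ℕ} (hp : p.Prime) {n : ℕ} (hn : 0 < n) :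
    ∃ (P : Type u) (_ : Group P) (a b : P), Finite P ∧ IsPGroup p P ∧
      a ^ p = 1 ∧ b ^ p = 1 ∧ (a * b) ^ n ≠ 1 := by
  let l : ℕ → List (Bool × ℤ) := fun n => (List.replicate n [(true, 1), (false, 1)]).flatten
  have hmem : ∀ n, ∀ x ∈ l n, x.2 = 1 := by
    intro n x hx
    simp only [l, List.mem_flatten, List.mem_replicate] at hx
    obtain ⟨_, ⟨-, rfl⟩, hx⟩ := hx
    fin_cases hx <;> rfl
  have hsucc : ∀ n, l (n + 1) = (true, 1) :: (false, 1) :: l n := fun n => by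
    simp [l, List.replicate_succ]
  have hchain : ∀ n, (l n).IsChain fun x y => x.1 ≠ y.1 := by
    intro n
    induction n with
    | zero => exact List.IsChain.nil
    | succ n ih =>
      rw [hsucc]
      refine List.isChain_cons_cons.2 ⟨by simp, ?_⟩
      rcases n with _ | n
      · exact List.isChain_singleton _
      · rw [hsucc] at ih ⊢
        exact List.isChain_cons_cons.2 ⟨by simp, ih⟩
  obtain ⟨P, _, y, hfin, hP, hy, hne⟩ := exists_isPGroup_word_ne_one.{u} hp (fun _ : Bool => True)
    (l := l n) (by obtain ⟨m, rfl⟩ := Nat.exists_eq_succ_of_ne_zero hn.ne'; simp [hsucc])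
    (hchain n) (fun x hx => by simp [hmem n x hx])
    (fun x hx _ h => hp.one_lt.ne' (by
      rw [hmem n x hx] at h
      exact_mod_cast Int.eq_one_of_dvd_one (by positivity) h))
  refine ⟨P, inferInstance, y true, y false, hfin, hP, hy _ trivial, hy _ trivial, ?_⟩
  convert hne using 1
  clear hne hn
  induction n with
  | zero => simp [l]
  | succ n ih => rw [pow_succ', ih, hsucc]; simp [mul_assoc]

/-! ### Generators and universal property of the fundamental group -/

namespace GraphOfGroups

variable {α : Type v} {β : Type w} {Γ : Graph α β}

section FundamentalGroup

variable (𝒢 : GraphOfGroups.{u} Γ) (T : Graph α β)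

theorem edgeSubgroup_ne_bot (e : Γ.edgeSet) (ε : Bool) (h : Nontrivial (𝒢.edgeGroup e)) :
    𝒢.edgeSubgroup e ε ≠ ⊥ := by
  obtain ⟨x, hx⟩ := exists_ne (1 : 𝒢.edgeGroup e)
  intro hbot
  have hmem : 𝒢.φ e ε x ∈ 𝒢.edgeSubgroup e ε := ⟨x, rfl⟩
  rw [hbot, Subgroup.mem_bot] at hmem
  exact hx (𝒢.φ_injective e ε (hmem.trans (map_one _).symm))

/-- The element `t_e` of the fundamental group. -/
def stableLetter (e : StableEdge Γ T) : 𝒢.FundamentalGroup T :=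
  QuotientGroup.mk' (𝒢.relatorClosure T) (𝒢.preT T e)

theorem of_φ_eq (e : Γ.edgeSet) (he : (e : β) ∈ T.edgeSet) (h : 𝒢.edgeGroup e) :
    𝒢.of T _ (𝒢.φ e true h) = 𝒢.of T _ (𝒢.φ e false h) := by
  rw [← mul_inv_eq_one, of, of, MonoidHom.comp_apply, MonoidHom.comp_apply, ← map_inv, ← map_mul]
  exact (QuotientGroup.eq_one_iff _).2 (Subgroup.subset_normalClosure (IsRelator.tree e he h))

theorem stableLetter_conj (e : StableEdge Γ T) (h : 𝒢.edgeGroup e.1) :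
    (𝒢.stableLetter T e)⁻¹ * 𝒢.of T _ (𝒢.φ e.1 true h) * 𝒢.stableLetter T e =
      𝒢.of T _ (𝒢.φ e.1 false h) := by
  rw [← mul_inv_eq_one, of, of, stableLetter, MonoidHom.comp_apply, MonoidHom.comp_apply,
    ← map_inv, ← map_inv, ← map_mul, ← map_mul, ← map_mul]
  exact (QuotientGroup.eq_one_iff _).2 (Subgroup.subset_normalClosure (IsRelator.stable e h))

variable {T} in
/-- The universal property of the fundamental group. -/
def lift {K : Type*} [Group K] (f : ∀ x, 𝒢.vertexGroup x →* K) (t : StableEdge Γ T → K)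
    (htree : ∀ (e : Γ.edgeSet), (e : β) ∈ T.edgeSet → ∀ h : 𝒢.edgeGroup e,
      f _ (𝒢.φ e true h) = f _ (𝒢.φ e false h))
    (hstable : ∀ (e : StableEdge Γ T) (h : 𝒢.edgeGroup e.1),
      (t e)⁻¹ * f _ (𝒢.φ e.1 true h) * t e = f _ (𝒢.φ e.1 false h)) :
    𝒢.FundamentalGroup T →* K :=
  QuotientGroup.lift _ (Monoid.Coprod.lift (Monoid.CoprodI.lift f) (FreeGroup.lift t)) <| by
    refine Subgroup.normalClosure_le_normal (N := MonoidHom.ker _) ?_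
    rintro _ (⟨e, he, h⟩ | ⟨e, h⟩)
    · simp [preOf, htree e he h]
    · simp [preOf, preT, hstable e h]

section Lift

variable {T} {K : Type*} [Group K] (f : ∀ x, 𝒢.vertexGroup x →* K) (t : StableEdge Γ T → K)
    (htree : ∀ (e : Γ.edgeSet), (e : β) ∈ T.edgeSet → ∀ h : 𝒢.edgeGroup e,
      f _ (𝒢.φ e true h) = f _ (𝒢.φ e false h))
    (hstable : ∀ (e : StableEdge Γ T) (h : 𝒢.edgeGroup e.1),
      (t e)⁻¹ * f _ (𝒢.φ e.1 true h) * t e = f _ (𝒢.φ e.1 false h))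

theorem lift_of (x : Γ.vertexSet) (g : 𝒢.vertexGroup x) :
    𝒢.lift f t htree hstable (𝒢.of T x g) = f x g := by
  change Monoid.Coprod.lift (Monoid.CoprodI.lift f) (FreeGroup.lift t) (𝒢.preOf T x g) = _
  simp [preOf]

theorem lift_stableLetter (e : StableEdge Γ T) :
    𝒢.lift f t htree hstable (𝒢.stableLetter T e) = t e := by
  change Monoid.Coprod.lift (Monoid.CoprodI.lift f) (FreeGroup.lift t) (𝒢.preT T e) = _
  simp [preT]

end Lift

/-- The vertex groups and the elements `t_e` generate the fundamental group. -/
theorem closure_eq_top :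
    Subgroup.closure ({g | ∃ x h, 𝒢.of T x h = g} ∪ Set.range (𝒢.stableLetter T)) = ⊤ := by
  set S := Subgroup.closure ({g | ∃ x h, 𝒢.of T x h = g} ∪ Set.range (𝒢.stableLetter T)) with hS
  rw [eq_top_iff]
  rintro g -
  obtain ⟨y, rfl⟩ := QuotientGroup.mk'_surjective (𝒢.relatorClosure T) g
  suffices y ∈ S.comap (QuotientGroup.mk' (𝒢.relatorClosure T)) from this
  induction y using Monoid.Coprod.induction_on with
  | inl m =>
    induction m using Monoid.CoprodI.induction_on with
    | one => rw [map_one]; exact one_mem _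
    | of x h => exact Subgroup.subset_closure (Or.inl ⟨x, h, rfl⟩)
    | mul m m' hm hm' => rw [map_mul]; exact mul_mem hm hm'
  | inr n =>
    have hof : ∀ e, Monoid.Coprod.inr (FreeGroup.of e) ∈
        S.comap (QuotientGroup.mk' (𝒢.relatorClosure T)) :=
      fun e => Subgroup.subset_closure (Or.inr ⟨e, rfl⟩)
    induction n using FreeGroup.induction_on with
    | C1 => rw [map_one]; exact one_mem _
    | of e => exact hof e
    | inv_of e _ => rw [map_inv]; exact inv_mem (hof e)
    | mul m m' hm hm' => rw [map_mul]; exact mul_mem hm hm'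
  | mul m m' hm hm' => exact mul_mem hm hm'

end FundamentalGroup

/-! ### Semidirect vertex groups with a common base -/

section Semidirect

variable {H D : Type u} [Group H] [Group D]

/-- The end `e(ε)` of the edge `e` for an arbitrary choice of directions. -/
noncomputable def chosenEnd (e : Γ.edgeSet) (ε : Bool) : Γ.vertexSet :=
  if ε then ⟨_, (Graph.exists_isLink_of_mem_edgeSet e.2).choose_spec.choose_spec.left_mem⟩
  else ⟨_, (Graph.exists_isLink_of_mem_edgeSet e.2).choose_spec.choose_spec.right_mem⟩

theorem isLink_chosenEnd (e : Γ.edgeSet) :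
    Γ.IsLink (e : β) (chosenEnd e true) (chosenEnd e false) :=
  (Graph.exists_isLink_of_mem_edgeSet e.2).choose_spec.choose_spec

/-- The graph of groups with the vertex groups `H ⋊ ⟨a v⟩` and the edge groups `H`, where the
embedding of `H` at the end of an edge `e` is twisted by the action of `c e`. -/
noncomputable def ofSemidirect (Γ : Graph α β) (φ : D →* MulAut H) (a : Γ.vertexSet → D)
    (c : Γ.edgeSet → D) : GraphOfGroups.{u} Γ where
  vertexGroup x := H ⋊[φ.comp (Subgroup.zpowers (a x)).subtype] Subgroup.zpowers (a x)
  endpt := chosenEnd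
  isLink_endpt := isLink_chosenEnd
  edgeGroup _ := H
  φ e ε := SemidirectProduct.inl.comp (φ (if ε then 1 else c e)).toMonoidHom
  φ_injective _ _ := SemidirectProduct.inl_injective.comp (MulEquiv.injective _)

variable (φ : D →* MulAut H) (a : Γ.vertexSet → D) (c : Γ.edgeSet → D) (T : Graph α β)

/-- The fundamental group of `ofSemidirect`. -/
abbrev SemidirectPi : Type (max u v w) := (ofSemidirect Γ φ a c).FundamentalGroup T

/-- The canonical homomorphism of the vertex group at `x` to the fundamental group. -/
noncomputable def ofVertex (x : Γ.vertexSet) :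
    H ⋊[φ.comp (Subgroup.zpowers (a x)).subtype] Subgroup.zpowers (a x) →* SemidirectPi φ a c T :=
  (ofSemidirect Γ φ a c).of T x

/-- The image of the base `H` of the vertex group at `x` in the fundamental group. -/
noncomputable def ofBase (x : Γ.vertexSet) : H →* SemidirectPi φ a c T :=
  (ofVertex φ a c T x).comp SemidirectProduct.inl

/-- The generators of the fundamental group modulo the base. -/
noncomputable def piGen : Γ.vertexSet ⊕ StableEdge Γ T → SemidirectPi φ a c T
  | Sum.inl x => ofVertex φ a c T x
      (SemidirectProduct.inr ⟨a x, Subgroup.mem_zpowers _⟩)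
  | Sum.inr e => (ofSemidirect Γ φ a c).stableLetter T e

/-- The elements by which the generators `piGen` act on the base. -/
def piAct : Γ.vertexSet ⊕ StableEdge Γ T → D
  | Sum.inl x => a x
  | Sum.inr e => (c e.1)⁻¹

variable {φ a c T}

theorem of_φ_ofSemidirect (e : Γ.edgeSet) (ε : Bool) (h : H) :
    (ofSemidirect Γ φ a c).of T _ ((ofSemidirect Γ φ a c).φ e ε h) =
      ofBase φ a c T (chosenEnd e ε) (φ (if ε then 1 else c e) h) := rfl

theorem ofBase_tree (e : Γ.edgeSet) (he : (e : β) ∈ T.edgeSet) (h : H) :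
    ofBase φ a c T (chosenEnd e true) h = ofBase φ a c T (chosenEnd e false) (φ (c e) h) := by
  have : ofBase φ a c T (chosenEnd e true) (φ (if true then 1 else c e) h) =
      ofBase φ a c T (chosenEnd e false) (φ (if false then 1 else c e) h) :=
    (ofSemidirect Γ φ a c).of_φ_eq T e he h
  simpa using this

theorem ofBase_stable (e : StableEdge Γ T) (h : H) :
    (piGen φ a c T (Sum.inr e))⁻¹ * ofBase φ a c T (chosenEnd e.1 true) h *
      piGen φ a c T (Sum.inr e) = ofBase φ a c T (chosenEnd e.1 false) (φ (c e.1) h) := by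
  have : (piGen φ a c T (Sum.inr e))⁻¹ *
      ofBase φ a c T (chosenEnd e.1 true) (φ (if true then 1 else c e.1) h) *
      piGen φ a c T (Sum.inr e) =
      ofBase φ a c T (chosenEnd e.1 false) (φ (if false then 1 else c e.1) h) :=
    (ofSemidirect Γ φ a c).stableLetter_conj T e h
  simpa using this

/-- The universal property of the fundamental group of `ofSemidirect`. -/
theorem exists_hom_ofVertex {K : Type*} [Group K]
    (f : ∀ x, H ⋊[φ.comp (Subgroup.zpowers (a x)).subtype] Subgroup.zpowers (a x) →* K)
    (t : StableEdge Γ T → K)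
    (htree : ∀ e : Γ.edgeSet, (e : β) ∈ T.edgeSet → ∀ h : H,
      f (chosenEnd e true) (SemidirectProduct.inl h) =
        f (chosenEnd e false) (SemidirectProduct.inl (φ (c e) h)))
    (hstable : ∀ (e : StableEdge Γ T) (h : H),
      (t e)⁻¹ * f (chosenEnd e.1 true) (SemidirectProduct.inl h) * t e =
        f (chosenEnd e.1 false) (SemidirectProduct.inl (φ (c e.1) h))) :
    ∃ F : SemidirectPi φ a c T →* K, (∀ x g, F (ofVertex φ a c T x g) = f x g) ∧
      ∀ e, F (piGen φ a c T (Sum.inr e)) = t e := by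
  have h1 : ∀ e : Γ.edgeSet, (e : β) ∈ T.edgeSet → ∀ h : H,
      f (chosenEnd e true) (SemidirectProduct.inl (φ (if true then 1 else c e) h)) =
        f (chosenEnd e false) (SemidirectProduct.inl (φ (if false then 1 else c e) h)) :=
    fun e he h => by simpa using htree e he h
  have h2 : ∀ (e : StableEdge Γ T) (h : H),
      (t e)⁻¹ * f (chosenEnd e.1 true)
        (SemidirectProduct.inl (φ (if true then 1 else c e.1) h)) * t e =
        f (chosenEnd e.1 false)
          (SemidirectProduct.inl (φ (if false then 1 else c e.1) h)) :=
    fun e h => by simpa using hstable e h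
  exact ⟨(ofSemidirect Γ φ a c).lift f t h1 h2,
    (ofSemidirect Γ φ a c).lift_of f t h1 h2, (ofSemidirect Γ φ a c).lift_stableLetter f t h1 h2⟩

theorem ofVertex_eq (x : Γ.vertexSet)
    (g : H ⋊[φ.comp (Subgroup.zpowers (a x)).subtype] Subgroup.zpowers (a x)) :
    ∃ k : ℤ, ofVertex φ a c T x g =
      ofBase φ a c T x g.left * piGen φ a c T (Sum.inl x) ^ k := by
  obtain ⟨k, hk⟩ := Subgroup.mem_zpowers_iff.1 g.right.2
  refine ⟨k, ?_⟩
  have hr : g.right = ⟨a x, Subgroup.mem_zpowers _⟩ ^ k := Subtype.ext hk.symm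
  conv_lhs => rw [← SemidirectProduct.inl_left_mul_inr_right g, hr, map_zpow]
  rw [map_mul, map_zpow]
  rfl

theorem piGen_pow_eq_one {p : ℕ} (ha : ∀ x, a x ^ p = 1) (x : Γ.vertexSet) :
    piGen φ a c T (Sum.inl x) ^ p = 1 := by
  rw [piGen, ← map_pow, ← map_pow]
  have : (⟨a x, Subgroup.mem_zpowers _⟩ : Subgroup.zpowers (a x)) ^ p = 1 := Subtype.ext (ha x)
  rw [this, map_one, map_one]

theorem ofBase_adj (hc : ∀ e : Γ.edgeSet, (e : β) ∈ T.edgeSet → c e = 1) (hT : T.IsMaximalTree Γ)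
    {x y : Γ.vertexSet} (hxy : T.Adj x y) : ofBase φ a c T x = ofBase φ a c T y := by
  obtain ⟨e, he⟩ := hxy
  have heT : e ∈ T.edgeSet := he.edge_mem
  have heΓ : Γ.IsLink e x y := he.mono hT.spanning.le
  have key : ofBase φ a c T (chosenEnd ⟨e, heΓ.edge_mem⟩ true) =
      ofBase φ a c T (chosenEnd ⟨e, heΓ.edge_mem⟩ false) := by
    ext h
    rw [ofBase_tree _ heT, hc _ heT, map_one, MulAut.one_apply]
  rcases (isLink_chosenEnd ⟨e, heΓ.edge_mem⟩).eq_and_eq_or_eq_and_eq heΓ with ⟨h1, h2⟩ | ⟨h1, h2⟩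
  · rwa [Subtype.ext h1, Subtype.ext h2] at key
  · rw [Subtype.ext h1, Subtype.ext h2] at key
    exact key.symm

/-- Edges of `T` are untwisted and identify the bases at their ends; `T` connects all vertices. -/
theorem ofBase_eq (hc : ∀ e : Γ.edgeSet, (e : β) ∈ T.edgeSet → c e = 1) (hT : T.IsMaximalTree Γ)
    (x y : Γ.vertexSet) : ofBase φ a c T x = ofBase φ a c T y := by
  have hV := hT.spanning.vertexSet_eq
  suffices ∀ x y : T.vertexSet, ofBase φ a c T ⟨x, hV ▸ x.2⟩ = ofBase φ a c T ⟨y, hV ▸ y.2⟩ from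
    this ⟨x, hV.symm ▸ x.2⟩ ⟨y, hV.symm ▸ y.2⟩
  intro x y
  obtain ⟨W⟩ := hT.isTree.connected.preconnected x y
  induction W with
  | nil => rfl
  | cons h _ ih => exact (ofBase_adj hc hT h.2).trans ih

/-- This makes the base normal. A stable letter acts by `(c e)⁻¹`, since its relation reads `t⁻¹ h t
= φ (c e) h`. -/
theorem piGen_mul_ofBase (hc : ∀ e : Γ.edgeSet, (e : β) ∈ T.edgeSet → c e = 1)
    (hT : T.IsMaximalTree Γ) (x : Γ.vertexSet) (i : Γ.vertexSet ⊕ StableEdge Γ T) (h : H) :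
    piGen φ a c T i * ofBase φ a c T x h =
      ofBase φ a c T x (φ (piAct a c T i) h) * piGen φ a c T i := by
  rcases i with y | e
  · rw [ofBase_eq hc hT x y]
    have := SemidirectProduct.inl_aut (φ := φ.comp (Subgroup.zpowers (a y)).subtype)
      ⟨a y, Subgroup.mem_zpowers _⟩ h
    rw [map_inv, ← mul_inv_eq_iff_eq_mul, inv_inv] at this
    have := congrArg (ofVertex φ a c T y) this
    rw [map_mul, map_mul] at this
    exact this.symm
  · have hrel := ofBase_stable (φ := φ) (a := a) (c := c) e ((φ (c e.1))⁻¹ h)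
    rw [ofBase_eq hc hT _ x, ofBase_eq hc hT (chosenEnd e.1 false) x,
      MulAut.apply_inv_self] at hrel
    rw [← hrel, piAct, map_inv, mul_assoc, mul_inv_cancel_left]

theorem mul_ofBase_pow {x : Γ.vertexSet} {g : SemidirectPi φ a c T} {d : D}
    (h : ∀ h, g * ofBase φ a c T x h = ofBase φ a c T x (φ d h) * g) (n : ℕ) (k : H) :
    g ^ n * ofBase φ a c T x k = ofBase φ a c T x (φ (d ^ n) k) * g ^ n := by
  induction n generalizing k with
  | zero => simp
  | succ n ih => rw [pow_succ, mul_assoc, h, ← mul_assoc, ih, mul_assoc, ← pow_succ, pow_succ d,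
      map_mul, MulAut.mul_apply]

/-- Every element of the fundamental group is a product of an element of the base and a word in
the generators `piGen`. -/
theorem exists_eq_ofBase_mul_word (hc : ∀ e : Γ.edgeSet, (e : β) ∈ T.edgeSet → c e = 1)
    (hT : T.IsMaximalTree Γ) (x : Γ.vertexSet) (g : SemidirectPi φ a c T) :
    ∃ (h : H) (l : List ((Γ.vertexSet ⊕ StableEdge Γ T) × ℤ)),
      g = ofBase φ a c T x h * (l.map fun y => piGen φ a c T y.1 ^ y.2).prod := by
  -- The elements that act on the base through some element of `D`; membership of words in `S` lets
  -- base elements be moved to the left past them.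
  let S : Subgroup (SemidirectPi φ a c T) :=
    { carrier := {g | ∃ d : D, ∀ h, g * ofBase φ a c T x h = ofBase φ a c T x (φ d h) * g}
      one_mem' := ⟨1, by simp⟩
      mul_mem' := by
        rintro g g' ⟨d, hd⟩ ⟨d', hd'⟩
        refine ⟨d * d', fun h => ?_⟩
        rw [mul_assoc, hd', ← mul_assoc, hd, map_mul, MulAut.mul_apply, mul_assoc]
      inv_mem' := by
        rintro g ⟨d, hd⟩
        refine ⟨d⁻¹, fun h => ?_⟩
        rw [inv_mul_eq_iff_eq_mul, ← mul_assoc, hd, ← MulAut.mul_apply, ← map_mul, mul_inv_cancel,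
          map_one, MulAut.one_apply, mul_inv_cancel_right] }
  have hword : ∀ l : List ((Γ.vertexSet ⊕ StableEdge Γ T) × ℤ),
      (l.map fun y => piGen φ a c T y.1 ^ y.2).prod ∈ S := fun l => by
    refine Subgroup.list_prod_mem _ fun y hy => ?_
    obtain ⟨z, -, rfl⟩ := List.mem_map.1 hy
    exact zpow_mem (show _ ∈ S from ⟨_, piGen_mul_ofBase hc hT x z.1⟩) _
  have hstep : ∀ (g : SemidirectPi φ a c T) (h : H) (y : (Γ.vertexSet ⊕ StableEdge Γ T) × ℤ),
      (∃ (h : H) (l : List ((Γ.vertexSet ⊕ StableEdge Γ T) × ℤ)),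
        g = ofBase φ a c T x h * (l.map fun y => piGen φ a c T y.1 ^ y.2).prod) →
      ∃ (h' : H) (l : List ((Γ.vertexSet ⊕ StableEdge Γ T) × ℤ)),
        g * (ofBase φ a c T x h * piGen φ a c T y.1 ^ y.2) =
          ofBase φ a c T x h' * (l.map fun y => piGen φ a c T y.1 ^ y.2).prod := by
    rintro _ h y ⟨h', l, rfl⟩
    obtain ⟨d, hd⟩ := hword l
    refine ⟨h' * φ d h, l ++ [y], ?_⟩
    rw [List.map_append, List.prod_append, List.map_singleton, List.prod_singleton, mul_assoc,
      ← mul_assoc _ (ofBase φ a c T x h), hd, map_mul, mul_assoc, mul_assoc]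
  have hvert : ∀ (g : SemidirectPi φ a c T) (y : Γ.vertexSet)
      (k : H ⋊[φ.comp (Subgroup.zpowers (a y)).subtype] Subgroup.zpowers (a y)),
      (∃ (h : H) (l : List ((Γ.vertexSet ⊕ StableEdge Γ T) × ℤ)),
        g = ofBase φ a c T x h * (l.map fun y => piGen φ a c T y.1 ^ y.2).prod) →
      ∃ (h' : H) (l : List ((Γ.vertexSet ⊕ StableEdge Γ T) × ℤ)),
        g * ofVertex φ a c T y k =
          ofBase φ a c T x h' * (l.map fun y => piGen φ a c T y.1 ^ y.2).prod := by
    intro g y k ih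
    obtain ⟨n, hn⟩ := ofVertex_eq (c := c) (T := T) y k
    rw [hn, ofBase_eq hc hT y x]
    exact hstep _ _ (Sum.inl y, n) ih
  have hg : g ∈ Subgroup.closure ({g | ∃ x h, (ofSemidirect Γ φ a c).of T x h = g} ∪
      Set.range ((ofSemidirect Γ φ a c).stableLetter T)) := by
    rw [closure_eq_top]; trivial
  induction hg using Subgroup.closure_induction_right with
  | one => exact ⟨1, [], by simp⟩
  | mul_right g hg s hs ih =>
    rcases hs with ⟨y, k, rfl⟩ | ⟨e, rfl⟩
    · exact hvert g y k ih
    · simpa [piGen] using hstep _ 1 (Sum.inr e, 1) ih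
  | mul_inv_cancel g hg s hs ih =>
    rcases hs with ⟨y, k, rfl⟩ | ⟨e, rfl⟩
    · rw [← map_inv]
      exact hvert g y k⁻¹ ih
    · simpa [piGen] using hstep _ 1 (Sum.inr e, -1) ih

/-- The fundamental group maps to `H ⋊ D`, injectively on the base. -/
theorem exists_hom_ofBase (hc : ∀ e : Γ.edgeSet, (e : β) ∈ T.edgeSet → c e = 1) :
    ∃ F : SemidirectPi φ a c T →* H ⋊[φ] D,
      ∀ x h, F (ofBase φ a c T x h) = SemidirectProduct.inl h := by
  obtain ⟨F, hF, -⟩ := exists_hom_ofVertex (c := c) (T := T)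
    (fun x => SemidirectProduct.map (MonoidHom.id H) (Subgroup.zpowers (a x)).subtype
      fun _ => rfl : ∀ x, H ⋊[φ.comp (Subgroup.zpowers (a x)).subtype] Subgroup.zpowers (a x) →*
        H ⋊[φ] D)
    (fun e => SemidirectProduct.inr (c e.1)⁻¹) (fun e he h => by simp [hc e he])
    (fun e h => by simp [SemidirectProduct.inl_aut])
  exact ⟨F, fun x h => (hF x _).trans (SemidirectProduct.map_inl ..)⟩

/-- The homomorphism of the fundamental group that kills the base and sends the generators
`piGen` to given elements. -/
theorem exists_hom_piGen {K : Type*} [Group K] (y : Γ.vertexSet ⊕ StableEdge Γ T → K)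
    (hy : ∀ x, orderOf (y (Sum.inl x)) ∣ orderOf (a x)) :
    ∃ f : SemidirectPi φ a c T →* K,
      (∀ x h, f (ofBase φ a c T x h) = 1) ∧ ∀ i, f (piGen φ a c T i) = y i := by
  have hgen : ∀ x, ∀ g : Subgroup.zpowers (a x),
      g ∈ Subgroup.zpowers (⟨a x, Subgroup.mem_zpowers _⟩ : Subgroup.zpowers (a x)) := by
    rintro x ⟨_, k, rfl⟩
    exact ⟨k, rfl⟩
  have hord : ∀ x, orderOf (y (Sum.inl x)) ∣
      orderOf (⟨a x, Subgroup.mem_zpowers _⟩ : Subgroup.zpowers (a x)) := fun x => by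
    rw [Subgroup.orderOf_mk]; exact hy x
  let F : ∀ x, H ⋊[φ.comp (Subgroup.zpowers (a x)).subtype] Subgroup.zpowers (a x) →* K := fun x =>
    (monoidHomOfForallMemZpowers (hgen x) (hord x)).comp SemidirectProduct.rightHom
  have hF : ∀ x (h : H), F x (SemidirectProduct.inl h) = 1 := fun x h => by
    simp only [F, MonoidHom.comp_apply, SemidirectProduct.rightHom_inl, map_one]
  obtain ⟨f, hf1, hf2⟩ := exists_hom_ofVertex (c := c) (T := T) F (fun e => y (Sum.inr e))
    (fun e _ h => (hF _ _).trans (hF _ _).symm)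
    (fun e h => by rw [hF, hF, mul_one, inv_mul_cancel])
  refine ⟨f, fun x h => (hf1 x _).trans (hF x h), ?_⟩
  rintro (x | e)
  · refine (hf1 x _).trans ?_
    change monoidHomOfForallMemZpowers (hgen x) (hord x) (SemidirectProduct.rightHom _) = _
    rw [SemidirectProduct.rightHom_inr, monoidHomOfForallMemZpowers_apply_gen]
  · exact hf2 e

/-- A twist is an automorphism of `H`, so it does not change the image of the edge group: every edge
subgroup contains the common base. -/
theorem ofBase_mem_edgeSubgroup (hc : ∀ e : Γ.edgeSet, (e : β) ∈ T.edgeSet → c e = 1)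
    (hT : T.IsMaximalTree Γ) (x : Γ.vertexSet) (h : H) (e : Γ.edgeSet) (ε : Bool) :
    ofBase φ a c T x h ∈ (ofSemidirect Γ φ a c).edgeSubgroupInFundamentalGroup T e ε := by
  rw [ofBase_eq hc hT x (chosenEnd e ε)]
  refine ⟨_, ⟨(φ (if ε then 1 else c e))⁻¹ h, rfl⟩, ?_⟩
  refine (of_φ_ofSemidirect e ε _).trans ?_
  rw [MulAut.apply_inv_self]

/-- If every non-trivial element of `H` survives in a `C`-quotient of `H ⋊ D` and `C` contains the
finite `p`-groups, the fundamental group is residually a `C`-group. -/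
theorem isResidually_semidirectPi {C : ∀ (G : Type u) [Group G], Prop} (hC : IsRootClass C)
    {p : ℕ} (hp : p.Prime)
    (hCp : ∀ (P : Type u) [Group P] [Finite P], IsPGroup p P → C P)
    (hsep : ∀ h : H, h ≠ 1 → ∃ (K : Type u) (_ : Group K) (f : H ⋊[φ] D →* K),
      C K ∧ f (SemidirectProduct.inl h) ≠ 1)
    (ha : ∀ x, orderOf (a x) = p) (hc : ∀ e : Γ.edgeSet, (e : β) ∈ T.edgeSet → c e = 1)
    (hT : T.IsMaximalTree Γ) (x : Γ.vertexSet) : IsResidually C (SemidirectPi φ a c T) := by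
  intro g hg
  obtain ⟨h, l, rfl⟩ := exists_eq_ofBase_mul_word hc hT x g
  obtain ⟨l, hchain, hgood, heq⟩ := exists_reduced_word (p := p)
    (fun i : Γ.vertexSet ⊕ StableEdge Γ T => i.isLeft) (piGen φ a c T) (by
      rintro (y | e) hi
      · exact piGen_pow_eq_one (fun x => ha x ▸ pow_orderOf_eq_one (a x)) y
      · simp at hi) l
  rw [heq] at hg ⊢
  by_cases hnil : l = []
  · subst hnil
    rw [List.map_nil, List.prod_nil, mul_one] at hg ⊢
    obtain ⟨K, _, f, hK, hf⟩ := hsep h fun h1 => hg (by rw [h1, map_one])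
    obtain ⟨F, hF⟩ := exists_hom_ofBase (φ := φ) (a := a) hc
    refine hC.exists_of_ne_one hK (f.comp F) ?_
    rwa [MonoidHom.comp_apply, hF]
  · obtain ⟨P, _, y, _, hP, hy, hne⟩ := exists_isPGroup_word_ne_one.{u} hp
      (fun i : Γ.vertexSet ⊕ StableEdge Γ T => (i.isLeft : Prop)) hnil hchain
      (fun x hx => (hgood x hx).1) (fun x hx => (hgood x hx).2)
    obtain ⟨f, hf1, hf2⟩ := exists_hom_piGen (φ := φ) (c := c) (T := T) y
      (a := a)
      (fun x => by rw [ha x]; exact orderOf_dvd_of_pow_eq_one (hy (Sum.inl x) rfl))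
    refine hC.exists_of_ne_one (hCp P hP) f ?_
    rw [map_mul, hf1, one_mul, map_list_prod, List.map_map]
    simpa only [Function.comp_def, map_zpow, hf2] using hne

/-- If some element of the fundamental group acts on the base as an element `d` no power of which
acts trivially, then homomorphisms to groups of finite exponent are not injective on the edge
subgroups. -/
theorem ker_inf_edgeSubgroup_ne_bot
    (hc : ∀ e : Γ.edgeSet, (e : β) ∈ T.edgeSet → c e = 1)
    (hT : T.IsMaximalTree Γ) (x : Γ.vertexSet) {d : D}
    (hd : ∀ n : ℕ, 0 < n → φ (d ^ n) ≠ 1) {g : SemidirectPi φ a c T}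
    (hg : ∀ h, g * ofBase φ a c T x h = ofBase φ a c T x (φ d h) * g)
    {Q : Type*} [Group Q] {n : ℕ} (hn : 0 < n) (hQ : ∀ q : Q, q ^ n = 1)
    (σ : SemidirectPi φ a c T →* Q) (e : Γ.edgeSet) (ε : Bool) :
    σ.ker ⊓ (ofSemidirect Γ φ a c).edgeSubgroupInFundamentalGroup T e ε ≠ ⊥ := by
  obtain ⟨h, hh⟩ : ∃ h, φ (d ^ n) h ≠ h := by
    by_contra! hcon
    exact hd n hn (MulEquiv.ext hcon)
  intro hbot
  -- As `σ (g ^ n) = 1`, conjugation by `g ^ n` is invisible under `σ`, so `h` and `φ (d ^ n) h`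
  -- have the same image.
  have hmem : ofBase φ a c T x (φ (d ^ n) h * h⁻¹) ∈
      σ.ker ⊓ (ofSemidirect Γ φ a c).edgeSubgroupInFundamentalGroup T e ε := by
    refine ⟨?_, ofBase_mem_edgeSubgroup hc hT x _ e ε⟩
    have := congrArg σ (mul_ofBase_pow hg n h)
    rw [map_mul, map_mul, map_pow, hQ, one_mul, mul_one] at this
    change σ _ = 1
    rw [map_mul, map_inv, map_mul, map_inv, ← this, mul_inv_cancel]
  rw [hbot, Subgroup.mem_bot] at hmem
  obtain ⟨F, hF⟩ := exists_hom_ofBase (φ := φ) (a := a) hc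
  have := congrArg F hmem
  rw [hF, map_one, ← map_one SemidirectProduct.inl] at this
  exact hh (mul_inv_eq_one.1 (SemidirectProduct.inl_injective this))

end Semidirect

end GraphOfGroups

/-! ### The action of the product of finite groups -/

/-- The product `∏ n, Q n` acts on the disjoint union of the `Q n` by translations. -/
abbrev sigmaTranslation (Q : ℕ → Type u) [∀ n, Group (Q n)] :
    MulAction (∀ n, Q n) (Σ n, Q n) where
  smul d x := ⟨x.1, d x.1 * x.2⟩
  one_smul x := Sigma.ext rfl (heq_of_eq (one_mul x.2))
  mul_smul d d' x := Sigma.ext rfl (heq_of_eq (mul_assoc (d x.1) (d' x.1) x.2))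

/-- The action of `∏ n, Q n` on the functions on the disjoint union of the `Q n`. -/
def sigmaAct (Q : ℕ → Type u) [∀ n, Group (Q n)] (Z : Type u) [Group Z] :
    (∀ n, Q n) →* MulAut ((Σ n, Q n) → Z) :=
  letI := sigmaTranslation Q
  mulAutArrow

/-- The projection to the `n`-th factor, a homomorphism to the wreath product of `Z` and `Q n`. -/
def sigmaProj (Q : ℕ → Type u) [∀ n, Group (Q n)] (Z : Type u) [Group Z] (n : ℕ) :
    ((Σ n, Q n) → Z) ⋊[sigmaAct Q Z] (∀ n, Q n) →*
      (Q n → Z) ⋊[(mulAutArrow : Q n →* MulAut (Q n → Z))] Q n :=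
  SemidirectProduct.map
    { toFun f q := f ⟨n, q⟩
      map_one' := rfl
      map_mul' _ _ := rfl }
    (Pi.evalMonoidHom Q n) fun _ => rfl

/-- On the copy of `Q n` where `d n ≠ 1`, the translation moves the point `1`, hence also a function
supported at that point. -/
theorem sigmaAct_ne_one {Q : ℕ → Type u} [∀ n, Group (Q n)] {Z : Type u} [Group Z] [Nontrivial Z]
    {d : ∀ n, Q n} (hd : d ≠ 1) : sigmaAct Q Z d ≠ 1 := by
  classical
  intro h
  obtain ⟨n, hn⟩ := Function.ne_iff.1 hd
  obtain ⟨z, hz⟩ := exists_ne (1 : Z)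
  have h1 := congrFun (DFunLike.congr_fun h (Pi.mulSingle ⟨n, 1⟩ z)) ⟨n, d n⟩
  have h2 : sigmaAct Q Z d (Pi.mulSingle ⟨n, 1⟩ z) ⟨n, d n⟩ =
      (Pi.mulSingle ⟨n, 1⟩ z : (Σ n, Q n) → Z) ⟨n, (d n)⁻¹ * d n⟩ := rfl
  rw [h2, inv_mul_cancel, Pi.mulSingle_eq_same, MulAut.one_apply, Pi.mulSingle_eq_of_ne] at h1
  · exact hz h1
  · intro h
    simp only [Sigma.mk.injEq, heq_eq_eq, true_and] at h
    exact hn h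

/-! ### The choice of the vertex groups and twists -/

theorem theorem3 (C : ∀ (G : Type u) [Group G], Prop) (hC : IsRootClass C)
    (hperiodic : ∀ (G : Type u) [Group G], C G → IsMulTorsion G)
    (hinfinite : ∃ (G : Type u) (_ : Group G), C G ∧ Infinite G)
    {α : Type v} {β : Type w} (Γ : Graph α β) (hconn : Γ.IsConnected)
    (hedge : Γ.edgeSet.Nonempty) :
    ∃ 𝒢 : GraphOfGroups.{u} Γ,
      (∀ x, C (𝒢.vertexGroup x)) ∧
      (∀ e ε, 𝒢.edgeSubgroup e ε ≠ ⊥) ∧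
      (∀ T : Graph α β, T.IsMaximalTree Γ → IsResidually C (𝒢.FundamentalGroup T)) ∧
      (∀ T : Graph α β, T.IsMaximalTree Γ →
        ∀ (Q : Type u) [Group Q] (σ : 𝒢.FundamentalGroup T →* Q),
          C Q → Function.Surjective σ →
            ∀ e ε, σ.ker ⊓ 𝒢.edgeSubgroupInFundamentalGroup T e ε ≠ ⊥) := by
  classical
  obtain ⟨Y, _, hY, _⟩ := hinfinite
  obtain ⟨p, Z, _, hp, hZ, hcard⟩ := hC.exists_prime_card hperiodic
  have hCp : ∀ (P : Type u) [Group P] [Finite P], IsPGroup p P → C P :=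
    fun P _ _ hP => hC.of_isPGroup hp hZ hcard P hP
  have : Nontrivial Z := by
    have : Finite Z := Nat.finite_of_card_ne_zero (hcard ▸ hp.ne_zero)
    exact Finite.one_lt_card_iff_nontrivial.1 (hcard ▸ hp.one_lt)
  choose Q instQ a b hfin hQ ha hb hab using fun n : ℕ =>
    exists_isPGroup_mul_pow_ne_one.{u} hp n.succ_pos
  have hab' : ∀ n : ℕ, 0 < n → (a * b) ^ n ≠ 1 := by
    intro n hn h
    have := congrFun h (n - 1)
    rw [Pi.pow_apply, Pi.mul_apply, ← Nat.sub_add_cancel hn] at this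
    exact hab (n - 1) this
  have hap : a ^ p = 1 := funext ha
  have hbp : b ^ p = 1 := funext hb
  have := Fact.mk hp
  -- If `a` were trivial, `(a * b) ^ p = b ^ p = 1` would contradict the infinite order of `a * b`;
  -- likewise for `b`.
  have horda : orderOf a = p := orderOf_eq_prime hap fun h =>
    hab' p hp.pos (by rw [h, one_mul, hbp])
  have hordb : orderOf b = p := orderOf_eq_prime hbp fun h =>
    hab' p hp.pos (by rw [h, mul_one, hap])
  obtain ⟨x₀⟩ := hconn.nonempty
  let A : Γ.vertexSet → ∀ n, Q n := fun x => if x = x₀ then a else b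
  have hA : ∀ x, orderOf (A x) = p := fun x => by
    simp only [A]; split_ifs <;> assumption
  -- Only loops are twisted. A maximal tree contains none, so the same graph of groups serves every
  -- `T`.
  let c : Γ.edgeSet → ∀ n, Q n := fun e =>
    if GraphOfGroups.chosenEnd e true = GraphOfGroups.chosenEnd e false then a * b else 1
  have hc : ∀ T : Graph α β, T.IsMaximalTree Γ → ∀ e : Γ.edgeSet, (e : β) ∈ T.edgeSet → c e = 1 := by
    intro T hT e he
    refine if_neg fun h => ?_
    have := hT.simple
    obtain ⟨x, y, hxy⟩ := Graph.exists_isLink_of_mem_edgeSet he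
    have hΓ := hxy.mono hT.spanning.le
    have hx := GraphOfGroups.isLink_chosenEnd e
    rw [h] at hx
    rcases hx.eq_and_eq_or_eq_and_eq hΓ with ⟨h1, h2⟩ | ⟨h1, h2⟩
    · exact hxy.ne (h1.symm.trans h2)
    · exact hxy.ne (h2.symm.trans h1)
  have hH : C ((Σ n, Q n) → Z) := hC.pi_of_countable hZ hY _
  refine ⟨GraphOfGroups.ofSemidirect Γ (sigmaAct Q Z) A c, fun x => ?_, fun e ε => ?_,
    fun T hT => ?_, fun T hT K _ σ hK _ e ε => ?_⟩
  · have hcardA : Nat.card (Subgroup.zpowers (A x)) = p := by rw [Nat.card_zpowers, hA]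
    have : Finite (Subgroup.zpowers (A x)) :=
      Nat.finite_of_card_ne_zero (hcardA ▸ hp.ne_zero)
    exact hC.semidirectProduct _ hH (hCp _ (IsPGroup.of_card (n := 1) (by rw [hcardA, pow_one])))
  · have : Nonempty (Σ n, Q n) := ⟨⟨0, 1⟩⟩
    exact GraphOfGroups.edgeSubgroup_ne_bot _ e ε
      (inferInstanceAs (Nontrivial ((Σ n, Q n) → Z)))
  · refine GraphOfGroups.isResidually_semidirectPi hC hp hCp (fun h hh => ?_) hA (hc T hT) hT x₀
    obtain ⟨⟨n, q⟩, hnq⟩ := Function.ne_iff.1 hh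
    refine ⟨_, inferInstance, sigmaProj Q Z n,
      hC.semidirectProduct _ (hC.power _ _ hZ (hCp _ (hQ n))) (hCp _ (hQ n)), fun h1 => hnq ?_⟩
    exact congrFun (congrArg SemidirectProduct.left h1) q
  · obtain ⟨m, hm, hKm⟩ := hC.exists_pow_eq_one hperiodic hY hK
    have hne : ∀ n : ℕ, 0 < n → sigmaAct Q Z ((a * b) ^ n) ≠ 1 :=
      fun n hn => sigmaAct_ne_one (hab' n hn)
    have hgen := GraphOfGroups.piGen_mul_ofBase (φ := sigmaAct Q Z) (a := A) (hc T hT) hT x₀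
    -- With two vertices, the product of their generators acts as `a * b`. With one vertex every
    -- edge is a loop, and the inverse of its stable letter acts as `a * b`.
    by_cases hV : ∃ x, x ≠ x₀
    · obtain ⟨x, hx⟩ := hV
      refine GraphOfGroups.ker_inf_edgeSubgroup_ne_bot (hc T hT) hT x₀ hne
        (g := GraphOfGroups.piGen _ A c T (Sum.inl x₀) * GraphOfGroups.piGen _ A c T (Sum.inl x))
        (fun h => ?_) hm hKm σ e ε
      rw [mul_assoc, hgen, ← mul_assoc, hgen, mul_assoc, map_mul, MulAut.mul_apply]
      simp only [GraphOfGroups.piAct, A, if_neg hx, if_true]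
    · push Not at hV
      obtain ⟨e₀, he₀⟩ := hedge
      have hloop : c ⟨e₀, he₀⟩ = a * b := if_pos ((hV _).trans (hV _).symm)
      have hnT : e₀ ∉ T.edgeSet := fun h =>
        hab' 1 one_pos (by rw [pow_one, ← hloop]; exact hc T hT _ h)
      refine GraphOfGroups.ker_inf_edgeSubgroup_ne_bot (hc T hT) hT x₀ hne
        (g := (GraphOfGroups.piGen _ A c T (Sum.inr ⟨⟨e₀, he₀⟩, hnT⟩))⁻¹)
        (fun h => ?_) hm hKm σ e ε
      rw [inv_mul_eq_iff_eq_mul, ← mul_assoc, hgen, GraphOfGroups.piAct, hloop, map_inv,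
        MulAut.inv_apply_self, mul_inv_cancel_right]
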